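/- \textbf{Corollary (Near-Optimal Individual Swap Regret).} Consider a finite normal-form game with $n \ge 2$ players, in which player $i$ has a finite action set $\mathcal A_i$ with $m_i := |\mathcal A_i| \ge 2$ and utility function $u_i : \prod_{j} \mathcal A_j \to [-1,1]$. The game is repeated at times $t = 0, 1, 2, \dots$, where time $0$ only serves as initialization. At time $t$ player $i$ plays a mixed strategy $x_i^{(t)} \in \Delta(\mathcal A_i)$ and observes the utility vector $u_i^{(t)} \in \mathbb R^{\mathcal A_i}$ with $u_i^{(t)}[b] := \mathbb E_{a_{-i} \sim x_{-i}^{(t)}}[u_i(b, a_{-i})]$, where the actions of the other players are drawn independently. The swap regret of player $i$ up to time $T$ is $$\mathrm{SwapReg}_i^T := \max_{\phi} \sum_{t=1}^T \langle \phi(x_i^{(t)}), u_i^{(t)} \rangle - \sum_{t=1}^T \langle x_i^{(t)}, u_i^{(t)} \rangle ,$$ where $\phi$ ranges over all linear maps that send $\Delta(\mathcal A_i)$ into itself. Player $i$ uses BM-OFTRL-LogBar with learning rate $\eta > 0$ if, at every time $t \ge 0$, the strategy $x_i^{(t)}$ is a stationary distribution of the row-stochastic matrix whose row indexed by $a \in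 \mathcal A_i$ is $x_{i,a}^{(t)}$. Here, with the log-barrier $\mathcal R(z) := -\sum_{b} \log z[b]$, the point $x_{i,a}^{(0)}$ is the minimizer of $\mathcal R$ over the relative interior of $\Delta(\mathcal A_i)$, and for $t \ge 1$, writing $u_{i,a}^{(\tau)} := x_i^{(\tau)}[a]\, u_i^{(\tau)}$, $$x_{i,a}^{(t)} := \arg\max_{z} \Big\{ \eta \Big\langle z,\; u_{i,a}^{(t-1)} + \sum_{\tau=1}^{t-1} u_{i,a}^{(\tau)} \Big\rangle - \mathcal R(z) \Big\}$$ over the relative interior of $\Delta(\mathcal A_i)$. Suppose that all players use BM-OFTRL-LogBar with $\eta = \dfrac{1}{128\,(n-1)\,\max_{j} \sqrt{m_j}}$. Then, for every player $i$ and every integer $T \ge 2$, $$\mathrm{SwapReg}_i^T \le 256\, \max_{j} \sqrt{m_j}\, \Big( (n-1)\, m_i^2 + \sum_{j=1}^n m_j^2 \Big) \log T .$$ -/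

import Mathlib

namespace LogSwap

section Regret

variable {A : Type*} [Fintype A]

/-- The linear transformations of the simplex `Δ(A)` into itself. -/
def swapTransformations (A : Type*) [Fintype A] : Set ((A → ℝ) → (A → ℝ)) :=
  {φ | IsLinearMap ℝ φ ∧ Set.MapsTo φ (stdSimplex ℝ A) (stdSimplex ℝ A)}

/-- The cumulative utility over `t = 1, …, T` of the transformed strategies `φ (x t)`. -/
noncomputable def cumUtility (φ : (A → ℝ) → (A → ℝ)) (x u : ℕ → A → ℝ) (T : ℕ) : ℝ :=
  ∑ t ∈ Finset.Icc 1 T, φ (x t) ⬝ᵥ u t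

/-- The `Φ`-regret up to time `T` of the strategies `x 1, …, x T` against the utility vectors
`u 1, …, u T`. -/
noncomputable def phiRegret (Φ : Set ((A → ℝ) → (A → ℝ))) (x u : ℕ → A → ℝ) (T : ℕ) : ℝ :=
  sSup ((fun φ => cumUtility φ x u T) '' Φ) - cumUtility id x u T

/-- Swap regret: `Φ`-regret for the set of all linear transformations of the simplex. -/
noncomputable def swapRegret (x u : ℕ → A → ℝ) (T : ℕ) : ℝ :=
  phiRegret (swapTransformations A) x u T

/-- The supremum in the definition of swap regret is an attained maximum. -/
theorem exists_isGreatest_cumUtility [Nonempty A] (x u : ℕ → A → ℝ) (T : ℕ) :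
    ∃ v, IsGreatest ((fun φ => cumUtility φ x u T) '' swapTransformations A) v := by
  classical
  have key : ∀ φ ∈ swapTransformations A, cumUtility φ x u T
      = ∑ a, φ (Pi.single a 1) ⬝ᵥ (fun b => ∑ t ∈ Finset.Icc 1 T, x t a * u t b) := by
    intro φ hφ
    have h1 : ∀ y : A → ℝ, φ y = ∑ a, y a • φ (Pi.single a 1) := by
      intro y
      have := (hφ.1.mk' φ).pi_apply_eq_sum_univ y
      simp only [IsLinearMap.mk'_apply] at this
      rw [this]
      refine Finset.sum_congr rfl fun a _ => ?_
      congr 2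
      ext b
      simp [Pi.single_apply, eq_comm]
    unfold cumUtility
    simp_rw [h1 (x _), dotProduct, Finset.sum_apply, Pi.smul_apply, smul_eq_mul, Finset.sum_mul,
      Finset.mul_sum]
    rw [Finset.sum_comm]
    simp_rw [Finset.sum_comm (s := Finset.Icc 1 T)]
    rw [Finset.sum_comm]
    refine Finset.sum_congr rfl fun a _ => Finset.sum_congr rfl fun b _ =>
      Finset.sum_congr rfl fun t _ => by ring
  choose g hg using fun a : A => Finite.exists_max (fun b => ∑ t ∈ Finset.Icc 1 T, x t a * u t b)
  have hsingle : ∀ a : A, (Pi.single a 1 : A → ℝ) ∈ stdSimplex ℝ A := single_mem_stdSimplex ℝ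
  have hmem : (fun y : A → ℝ => ∑ a, y a • (Pi.single (g a) 1 : A → ℝ)) ∈
      swapTransformations A := by
    refine ⟨⟨?_, ?_⟩, ?_⟩
    · intro y z; simp [add_smul, Finset.sum_add_distrib]
    · intro c y; simp [mul_smul, Finset.smul_sum]
    · intro y hy
      exact (convex_stdSimplex ℝ A).sum_mem (fun a _ => hy.1 a) hy.2 (fun a _ => hsingle _)
  refine ⟨_, ⟨_, hmem, rfl⟩, ?_⟩
  rintro _ ⟨φ, hφ, rfl⟩
  simp only
  rw [key φ hφ, key _ hmem]
  refine Finset.sum_le_sum fun a _ => ?_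
  have h2 : (∑ a', (Pi.single a 1 : A → ℝ) a' • (Pi.single (g a') 1 : A → ℝ))
      = Pi.single (g a) 1 := by
    rw [Finset.sum_eq_single a] <;> simp +contextual
  rw [h2, single_one_dotProduct]
  have h3 := hφ.2 (hsingle a)
  calc φ (Pi.single a 1) ⬝ᵥ (fun b => ∑ t ∈ Finset.Icc 1 T, x t a * u t b)
      ≤ ∑ b, φ (Pi.single a 1) b * ∑ t ∈ Finset.Icc 1 T, x t a * u t (g a) :=
        Finset.sum_le_sum fun b _ => mul_le_mul_of_nonneg_left (hg a b) (h3.1 b)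
    _ = _ := by rw [← Finset.sum_mul, h3.2, one_mul]

end Regret

section Algorithm

variable {A : Type*} [Fintype A]

/-- The relative interior of the simplex `Δ(A)`, which is the domain of the log-barrier. -/
def relintSimplex (A : Type*) [Fintype A] : Set (A → ℝ) :=
  {z | z ∈ stdSimplex ℝ A ∧ ∀ a, 0 < z a}

/-- The log-barrier on the simplex. -/
noncomputable def logBarrier (z : A → ℝ) : ℝ := -∑ a, Real.log (z a)

/-- `y 0, y 1, y 2, …` are the iterates of optimistic follow-the-regularized-leader over the simplex
with the log-barrier, learning rate `η`, utilities `u t` and predictions `m t = u (t - 1)` for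
`t ≥ 1`. The barrier is infinite on the relative boundary, so the optimization is over the relative
interior. -/
structure IsOFTRLLogBar (η : ℝ) (u y : ℕ → A → ℝ) : Prop where
  mem : ∀ t, y t ∈ relintSimplex A
  init : IsMinOn logBarrier (relintSimplex A) (y 0)
  step : ∀ t, IsMaxOn
    (fun z => η * (z ⬝ᵥ (u t + ∑ τ ∈ Finset.Icc 1 t, u τ)) - logBarrier z)
    (relintSimplex A) (y (t + 1))

/-- `p` is a stationary distribution of the row-stochastic matrix `Q`. -/
def IsStationary (Q : Matrix A A ℝ) (p : A → ℝ) : Prop :=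
  p ∈ stdSimplex ℝ A ∧ Q.transpose.mulVec p = p

/-- The strategies `x 0, x 1, …` are produced by the Blum–Mansour master algorithm against the
observed utilities `u 0, u 1, …`: row `a` of `Q t` is the iterate of a separate copy of
OFTRL with log-barrier that observes the utilities `x t a • u t`, and `x t` is a stationary
distribution of `Q t`. -/
def IsBMOFTRLLogBar (η : ℝ) (u x : ℕ → A → ℝ) : Prop :=
  ∃ Q : ℕ → Matrix A A ℝ,
    (∀ a, IsOFTRLLogBar η (fun t => x t a • u t) (fun t => Q t a)) ∧
    ∀ t, IsStationary (Q t) (x t)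

end Algorithm

section Game

variable {n : ℕ} {A : Fin n → Type*} [∀ i, Fintype (A i)] [∀ i, DecidableEq (A i)]

/-- The utility vector of player `i` under mixed strategies `x`: its coordinate at `b` is the
expectation of the utility `v` of player `i` when `i` plays `b` and every other player `j`
independently draws an action from `x j`. -/
noncomputable def utilityVector (i : Fin n) (v : (∀ j, A j) → ℝ) (x : ∀ j, A j → ℝ) : A i → ℝ :=
  fun b => ∑ a : (∀ j, A j) with a i = b, v a * ∏ j ∈ Finset.univ.erase i, x j (a j)

/-- In the game with utility functions `v`, the sequence of mixed strategy profiles `x 0, x 1, …`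
arises when every player runs the Blum–Mansour algorithm over OFTRL with log-barrier, with learning
rate `η`, on its own observed utility vectors. -/
def IsBMOFTRLPlay (v : Fin n → (∀ j, A j) → ℝ) (η : ℝ) (x : ℕ → ∀ i, A i → ℝ) : Prop :=
  ∀ i, IsBMOFTRLLogBar η (fun t => utilityVector i (v i) (x t)) (fun t => x t i)

end Game

section WellPosed

theorem exists_isMaxOn_barrier {A : Type*} [Fintype A] [Nonempty A] (L : A → ℝ) :
    ∃ y ∈ relintSimplex A, IsMaxOn (fun z => z ⬝ᵥ L - logBarrier z) (relintSimplex A) y := by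
  classical
  set F : (A → ℝ) → ℝ := fun z => z ⬝ᵥ L - logBarrier z with hF
  have hc : (0 : ℝ) < Fintype.card A := by exact_mod_cast Fintype.card_pos
  set c : A → ℝ := fun _ => (Fintype.card A : ℝ)⁻¹ with hcdef
  have hcS : c ∈ stdSimplex ℝ A := by
    refine ⟨fun a => by positivity, ?_⟩
    simp [hcdef, hc.ne']
  set δ : ℝ := min (Fintype.card A : ℝ)⁻¹ (Real.exp (F c - ∑ a, |L a|)) with hδ
  have hδ0 : 0 < δ := lt_min (by positivity) (Real.exp_pos _)
  set K : Set (A → ℝ) := stdSimplex ℝ A ∩ {z | ∀ a, δ ≤ z a} with hK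
  have hKc : IsCompact K := by
    refine (isCompact_stdSimplex ℝ A).inter_right ?_
    simp only [Set.ofPred_forall]
    exact isClosed_iInter fun a => isClosed_le continuous_const (continuous_apply a)
  have hcK : c ∈ K := ⟨hcS, fun a => min_le_left _ _⟩
  have hcont : ContinuousOn F K := by
    simp only [hF, logBarrier, dotProduct]
    refine ContinuousOn.sub (by fun_prop) (ContinuousOn.neg ?_)
    refine continuousOn_finsetSum _ fun a _ => ?_
    refine ContinuousOn.log (by fun_prop) fun z hz => (hδ0.trans_le (hz.2 a)).ne'
  obtain ⟨y, hyK, hy⟩ := hKc.exists_isMaxOn ⟨c, hcK⟩ hcont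
  refine ⟨y, ⟨hyK.1, fun a => hδ0.trans_le (hyK.2 a)⟩, ?_⟩
  intro z hz
  by_cases hzK : z ∈ K
  · exact hy hzK
  · have : ∃ a, z a < δ := by
      by_contra! h
      exact hzK ⟨hz.1, h⟩
    obtain ⟨a, ha⟩ := this
    have hle1 : ∀ b, z b ≤ 1 := fun b => by
      rw [← hz.1.2]
      exact Finset.single_le_sum (fun b _ => hz.1.1 b) (Finset.mem_univ b)
    have h1 : z ⬝ᵥ L ≤ ∑ b, |L b| := by
      refine Finset.sum_le_sum fun b _ => ?_
      calc z b * L b ≤ z b * |L b| := mul_le_mul_of_nonneg_left (le_abs_self _) (hz.1.1 b)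
        _ ≤ 1 * |L b| := mul_le_mul_of_nonneg_right (hle1 b) (abs_nonneg _)
        _ = _ := one_mul _
    have h2 : ∑ b, Real.log (z b) ≤ F c - ∑ b, |L b| := by
      calc ∑ b, Real.log (z b) ≤ Real.log (z a) := by
            rw [← Finset.add_sum_erase _ _ (Finset.mem_univ a)]
            have := Finset.sum_nonpos fun b (_ : b ∈ Finset.univ.erase a) =>
              Real.log_nonpos (hz.1.1 b) (hle1 b)
            linarith
        _ ≤ Real.log (Real.exp (F c - ∑ b, |L b|)) :=
            Real.log_le_log (hz.2 a) (ha.le.trans (min_le_right _ _))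
        _ = _ := Real.log_exp _
    have h3 : F z ≤ F c := by
      simp only [hF, logBarrier] at h2 ⊢
      linarith
    exact h3.trans (hy hcK)

theorem exists_isStationary {A : Type*} [Fintype A] [Nonempty A] (Q : Matrix A A ℝ)
    (hQ : ∀ a, Q a ∈ stdSimplex ℝ A) : ∃ p, IsStationary Q p := by
  classical
  have hdet : (Q - 1).det = 0 := by
    apply Matrix.exists_mulVec_eq_zero_iff.mp
    refine ⟨fun _ => 1, fun h => one_ne_zero (congrFun h (Classical.arbitrary A)), ?_⟩
    ext a
    have := (hQ a).2
    simp [Matrix.mulVec, dotProduct, this, Matrix.one_apply]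
  obtain ⟨w, hw0, hw⟩ := Matrix.exists_vecMul_eq_zero_iff.mpr hdet
  have hw' : ∀ b, ∑ a, w a * Q a b = w b := fun b => by
    have := congrFun hw b
    simp only [Matrix.vecMul_sub, Matrix.vecMul_one, Pi.sub_apply, Pi.zero_apply] at this
    have h := sub_eq_zero.mp this
    simpa [Matrix.vecMul, dotProduct] using h
  have hle : ∀ b, |w b| ≤ ∑ a, |w a| * Q a b := fun b => by
    rw [← hw' b]
    refine (Finset.abs_sum_le_sum_abs _ _).trans (Finset.sum_le_sum fun a _ => ?_)
    rw [abs_mul, abs_of_nonneg ((hQ a).1 b)]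
  have hsum : ∑ b, |w b| = ∑ b, ∑ a, |w a| * Q a b := by
    rw [Finset.sum_comm]
    refine Finset.sum_congr rfl fun a _ => ?_
    rw [← Finset.mul_sum, (hQ a).2, mul_one]
  have heq : ∀ b, |w b| = ∑ a, |w a| * Q a b := fun b =>
    (Finset.sum_eq_sum_iff_of_le fun b _ => hle b).mp hsum b (Finset.mem_univ b)
  have hpos : 0 < ∑ b, |w b| := by
    obtain ⟨a, ha⟩ := Function.ne_iff.mp hw0
    exact Finset.sum_pos' (fun b _ => abs_nonneg _) ⟨a, Finset.mem_univ a, abs_pos.mpr ha⟩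
  refine ⟨fun b => |w b| / ∑ b, |w b|, ⟨fun b => by positivity, ?_⟩, ?_⟩
  · rw [← Finset.sum_div, div_self hpos.ne']
  · ext b
    simp only [Matrix.mulVec, dotProduct, Matrix.transpose_apply]
    rw [heq b, Finset.sum_div]
    refine Finset.sum_congr rfl fun a _ => by ring

variable {n : ℕ} {A : Fin n → Type*} [∀ i, Fintype (A i)] [∀ i, DecidableEq (A i)]

/-- The dynamics are well posed: a play of all players exists in every finite game. -/
theorem exists_isBMOFTRLPlay [∀ i, Nonempty (A i)] (v : Fin n → (∀ j, A j) → ℝ) (η : ℝ) :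
    ∃ x : ℕ → ∀ i, A i → ℝ, IsBMOFTRLPlay v η x := by
  choose opt hoptm hopt using fun (i : Fin n) (L : A i → ℝ) => exists_isMaxOn_barrier L
  choose st hst using fun (i : Fin n) (Q : {Q : Matrix (A i) (A i) ℝ //
    ∀ a, Q a ∈ stdSimplex ℝ (A i)}) => exists_isStationary Q.1 Q.2
  let U : (ℕ → ∀ i, A i → ℝ) → ∀ i, A i → ℕ → A i → ℝ := fun h i a t =>
    h t i a • utilityVector i (v i) (h t)
  let score : (ℕ → ∀ i, A i → ℝ) → ℕ → ∀ i, A i → A i → ℝ := fun h t i a =>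
    match t with
    | 0 => 0
    | t + 1 => η • (U h i a t + ∑ τ ∈ Finset.Icc 1 t, U h i a τ)
  let mat : (ℕ → ∀ i, A i → ℝ) → ℕ → ∀ i, {Q : Matrix (A i) (A i) ℝ //
      ∀ a, Q a ∈ stdSimplex ℝ (A i)} := fun h t i =>
    ⟨fun a => opt i (score h t i a), fun a => (hoptm i (score h t i a)).1⟩
  have hscore : ∀ h h' t, (∀ τ < t, h τ = h' τ) → score h t = score h' t := by
    intro h h' t hh
    cases t with
    | zero => rfl
    | succ t =>
      funext i a
      have hU : ∀ τ ≤ t, U h i a τ = U h' i a τ := fun τ hτ => by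
        simp only [U, hh τ (Nat.lt_succ_of_le hτ)]
      simp only [score]
      rw [hU t le_rfl, Finset.sum_congr rfl fun τ hτ => hU τ (Finset.mem_Icc.mp hτ).2]
  let hist : ℕ → ℕ → ∀ i, A i → ℝ := fun t =>
    Nat.rec (fun _ _ _ => 0)
      (fun t h => Function.update h t (fun i => st i (mat h t i))) t
  have hist_succ : ∀ t, hist (t + 1) =
      Function.update (hist t) t (fun i => st i (mat (hist t) t i)) := fun t => rfl
  have hstable : ∀ t τ, τ < t → hist t τ = hist (τ + 1) τ := by
    intro t
    induction t with
    | zero => intro τ h; omega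
    | succ t ih =>
      intro τ h
      rcases Nat.lt_succ_iff_lt_or_eq.mp h with h | rfl
      · rw [hist_succ, Function.update_of_ne h.ne, ih τ h]
      · rfl
  let x : ℕ → ∀ i, A i → ℝ := fun t => hist (t + 1) t
  have hx : ∀ t i, x t i = st i (mat x t i) := by
    intro t i
    have h1 : mat (hist t) t = mat x t := by
      simp only [mat]
      rw [hscore (hist t) x t fun τ hτ => hstable t τ hτ]
    rw [← h1]
    simp only [x]
    rw [hist_succ, Function.update_self]
  refine ⟨x, fun i => ⟨fun t => (mat x t i).1, fun a => ⟨fun t => hoptm i _, ?_, fun t => ?_⟩,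
    fun t => ?_⟩⟩
  · intro z hz
    have := hopt i (score x 0 i a) hz
    simp only [score, Set.mem_ofPred_eq, dotProduct_zero, zero_sub] at this
    exact neg_le_neg_iff.mp this
  · intro z hz
    have := hopt i (score x (t + 1) i a) hz
    simp only [score, Set.mem_ofPred_eq, dotProduct_smul, smul_eq_mul] at this
    exact this
  · have h := hst i (mat x t i)
    rw [← hx t i] at h
    exact h

end WellPosed

end LogSwap

/-! A linear map of the simplex is determined by its values at the vertices, and `x t` is stationary
for `Q t`. So swap regret splits exactly into the external regrets of the rows, row `a` facing the
utilities `x t a • u t`.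

Each row satisfies a bound of the type "barrier range + `η²` · variation of utilities − movement of
the iterates" (`exists_regret_le_log`), the movement being measured by the log-barrier divergence.
This divergence controls multiplicative changes of the row entries, and multiplicative changes of
the rows of a positive stochastic matrix move its stationary distribution by a comparable amount in
`ℓ₁` (`sum_abs_stationary_sub_le`). With `m` actions, the negative terms of the rows thus dominate
`‖x (t+1) − x t‖₁² / (64 m)`, giving `IsBMOFTRLLogBar.swapRegret_le`.

In a game, the utilities of one player vary at most as much as the strategies of the others
(`abs_utilityVector_sub_le`). Summing the bounds over all players, the negative terms beat the
variation terms for the chosen `η`. Since swap regret is nonnegative, the total squared path length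
is `O(max m · ∑ m_j² · log T)`. Inserting this into the bound of a single player gives the result.
-/

namespace LogSwap

/-! ### Log-barrier divergence and the regret of optimistic FTRL -/

section Barrier

variable {A : Type*} [Fintype A]

/-- The Bregman divergence of the log-barrier on the positive orthant. -/
noncomputable def logBarrierDiv (x y : A → ℝ) : ℝ :=
  ∑ b, (x b / y b - 1 - Real.log (x b / y b))

theorem sub_one_sub_log_nonneg {r : ℝ} (hr : 0 < r) : 0 ≤ r - 1 - Real.log r := by
  linarith [Real.log_le_sub_one_of_pos hr]

theorem logBarrierDiv_nonneg {x y : A → ℝ} (hx : ∀ b, 0 < x b) (hy : ∀ b, 0 < y b) :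
    0 ≤ logBarrierDiv x y :=
  Finset.sum_nonneg fun b _ => sub_one_sub_log_nonneg (div_pos (hx b) (hy b))

theorem logBarrierDiv_self {x : A → ℝ} (hx : ∀ b, 0 < x b) : logBarrierDiv x x = 0 := by
  simp [logBarrierDiv, div_self (hx _).ne']

theorem add_smul_sub_mem_relintSimplex {y z : A → ℝ} (hy : y ∈ relintSimplex A)
    (hz : z ∈ stdSimplex ℝ A) {s : ℝ} (hs0 : 0 ≤ s) (hs1 : s < 1) :
    y + s • (z - y) ∈ relintSimplex A := by
  have h : ∀ b, (y + s • (z - y)) b = (1 - s) * y b + s * z b := fun b => by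
    simp only [Pi.add_apply, Pi.smul_apply, Pi.sub_apply, smul_eq_mul]; ring
  have hpos : ∀ b, 0 < (y + s • (z - y)) b := fun b => by
    rw [h]
    have := mul_pos (sub_pos.mpr hs1) (hy.2 b)
    have := mul_nonneg hs0 (hz.1 b)
    linarith
  refine ⟨⟨fun b => (hpos b).le, ?_⟩, hpos⟩
  simp_rw [h, Finset.sum_add_distrib, ← Finset.mul_sum, hy.1.2, hz.2]
  ring

/-- A maximizer of a linear function regularized by the log-barrier beats every other point by at
least the Bregman divergence. -/
theorem IsMaxOn.add_logBarrierDiv_le {L y : A → ℝ} (hy : y ∈ relintSimplex A)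
    (hmax : IsMaxOn (fun z => z ⬝ᵥ L - logBarrier z) (relintSimplex A) y)
    {z : A → ℝ} (hz : z ∈ relintSimplex A) :
    z ⬝ᵥ L - logBarrier z + logBarrierDiv z y ≤ y ⬝ᵥ L - logBarrier y := by
  set f : ℝ → ℝ := fun s => (y + s • (z - y)) ⬝ᵥ L - logBarrier (y + s • (z - y)) with hf
  have hd : HasDerivAt f ((z - y) ⬝ᵥ L + ∑ b, (z b - y b) / y b) 0 := by
    have h1 : f = fun s => ∑ b, ((y b + s * (z b - y b)) * L b
        + Real.log (y b + s * (z b - y b))) := by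
      funext s
      simp only [hf, logBarrier, dotProduct, Pi.add_apply, Pi.smul_apply, Pi.sub_apply,
        smul_eq_mul, Finset.sum_add_distrib]
      ring
    rw [h1]
    have h2 : (z - y) ⬝ᵥ L + ∑ b, (z b - y b) / y b
        = ∑ b, ((z b - y b) * L b + (z b - y b) / (y b + 0 * (z b - y b))) := by
      simp [dotProduct, Finset.sum_add_distrib]
    rw [h2]
    refine HasDerivAt.fun_sum fun b _ => ?_
    have h3 : HasDerivAt (fun s : ℝ => y b + s * (z b - y b)) (z b - y b) 0 := by
      simpa using ((hasDerivAt_id (0 : ℝ)).mul_const (z b - y b)).const_add (y b)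
    exact (h3.mul_const (L b)).add (h3.log (by simpa using (hy.2 b).ne'))
  -- First-order optimality: the slopes from `y` towards `z` are nonpositive for `0 < s < 1`. The
  -- divergence is what strict concavity of `-logBarrier` adds to this.
  have hle : (z - y) ⬝ᵥ L + ∑ b, (z b - y b) / y b ≤ 0 := by
    have hslope := (hasDerivWithinAt_iff_tendsto_slope' (s := Set.Ioi (0 : ℝ)) (by simp)).mp
      hd.hasDerivWithinAt
    refine le_of_tendsto hslope ?_
    filter_upwards [Ioo_mem_nhdsGT (zero_lt_one' ℝ)] with s hs
    rw [slope_def_field]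
    refine div_nonpos_of_nonpos_of_nonneg ?_ (by linarith [hs.1])
    have := hmax (add_smul_sub_mem_relintSimplex hy hz.1 hs.1.le hs.2)
    simp only [Set.mem_ofPred_eq] at this
    simp only [hf, zero_smul, add_zero]
    linarith
  have hD : logBarrierDiv z y = ∑ b, (z b - y b) / y b + logBarrier z - logBarrier y := by
    have : ∀ b, z b / y b - 1 - Real.log (z b / y b)
        = (z b - y b) / y b - Real.log (z b) + Real.log (y b) := fun b => by
      rw [Real.log_div (hz.2 b).ne' (hy.2 b).ne', sub_div, div_self (hy.2 b).ne']
      ring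
    simp only [logBarrierDiv, this, logBarrier, Finset.sum_add_distrib, Finset.sum_sub_distrib]
    ring
  rw [sub_dotProduct] at hle
  linarith

/-- Fenchel's inequality: the supremum over `r` of the left side is `-c - log (1 - c)`, which is
quadratic in `c` near `0`. It comes from `log (r (1 - c)) ≤ r (1 - c) - 1`. -/
theorem mul_sub_one_sub_le {c r : ℝ} (hc : |c| ≤ 1 / 2) (hr : 0 < r) :
    c * (r - 1) - (r - 1 - Real.log r) ≤ 2 * c ^ 2 := by
  have hc' := abs_le.mp hc
  have h0 : 0 < 1 - c := by linarith
  have h1 := Real.abs_log_sub_add_sum_range_le (show |c| < 1 by linarith) 1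
  simp only [Finset.range_one, Finset.sum_singleton, zero_add, pow_one, Nat.cast_zero, div_one,
    Nat.reduceAdd, sq_abs] at h1
  have h2 : c ^ 2 / (1 - |c|) ≤ 2 * c ^ 2 := by
    rw [div_le_iff₀ (by linarith)]
    nlinarith [sq_nonneg c]
  have h3 := Real.log_le_sub_one_of_pos (mul_pos hr h0)
  rw [Real.log_mul hr.ne' h0.ne'] at h3
  have h4 := (abs_le.mp h1).1
  nlinarith

/-- The local stability inequality of the log-barrier: a linear gain is controlled by half of the
divergence and the squared size of the linear function. -/
theorem mul_sub_dotProduct_le {g y d : A → ℝ} {η w : ℝ} (hg : ∀ b, 0 < g b)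
    (hy : y ∈ relintSimplex A) (hη : 0 ≤ η) (hd : ∀ b, |d b| ≤ w) (hw : η * w ≤ 1 / 4) :
    η * ((g - y) ⬝ᵥ d) - logBarrierDiv g y / 2 ≤ 4 * η ^ 2 * w ^ 2 := by
  have hy1 : ∀ b, y b ≤ 1 := fun b => by
    rw [← hy.1.2]
    exact Finset.single_le_sum (fun b _ => hy.1.1 b) (Finset.mem_univ b)
  -- The scalar inequality is used with `r = g b / y b` and `c = 2 η y_b d_b`; as `y_b² ≤ y_b`, the
  -- errors sum over `b` without a dimension factor.
  have key : ∀ b, η * ((g b - y b) * d b) - (g b / y b - 1 - Real.log (g b / y b)) / 2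
      ≤ y b * (4 * η ^ 2 * w ^ 2) := by
    intro b
    have hb := hy.2 b
    have h1 : |2 * η * y b * d b| ≤ 2 * η * y b * w := by
      rw [abs_mul, abs_of_nonneg (by positivity)]
      exact mul_le_mul_of_nonneg_left (hd b) (by positivity)
    have hw0 : 0 ≤ w := (abs_nonneg _).trans (hd b)
    have h2 : 2 * η * y b * w ≤ 1 / 2 := by
      have := mul_le_mul_of_nonneg_left (hy1 b) (mul_nonneg hη hw0)
      nlinarith
    have h3 := mul_sub_one_sub_le (h1.trans h2) (div_pos (hg b) hb)
    have h4 : 2 * η * y b * d b * (g b / y b - 1) = 2 * (η * ((g b - y b) * d b)) := by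
      field_simp
    have h5 : (2 * η * y b * d b) ^ 2 ≤ (2 * η * y b * w) ^ 2 := sq_le_sq' (by
      linarith [(abs_le.mp h1).1]) (abs_le.mp h1).2
    have h6 : y b ^ 2 * (4 * η ^ 2 * w ^ 2) ≤ y b * (4 * η ^ 2 * w ^ 2) :=
      mul_le_mul_of_nonneg_right (by nlinarith [hy1 b]) (by positivity)
    nlinarith
  have := Finset.sum_le_sum fun b (_ : b ∈ Finset.univ) => key b
  rw [← Finset.sum_mul, hy.1.2, one_mul, Finset.sum_sub_distrib, ← Finset.sum_div,
    ← Finset.mul_sum] at this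
  exact this

theorem sum_Icc_one_eq_sum_range {M : Type*} [AddCommMonoid M] (f : ℕ → M) (T : ℕ) :
    ∑ t ∈ Finset.Icc 1 T, f t = ∑ t ∈ Finset.range T, f (t + 1) := by
  induction T with
  | zero => simp
  | succ T ih => rw [Finset.sum_Icc_succ_top (by omega), ih, Finset.sum_range_succ]

/-- The regret bound of optimistic follow-the-regularized-leader, with the auxiliary iterates `g`
that do not use the predictions. -/
theorem IsOFTRLLogBar.exists_regret_le {η : ℝ} {u y : ℕ → A → ℝ} [Nonempty A]
    (h : IsOFTRLLogBar η u y) :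
    ∃ g : ℕ → A → ℝ, g 0 = y 0 ∧ (∀ t, g t ∈ relintSimplex A) ∧
      ∀ z ∈ relintSimplex A, ∀ T,
        η * ∑ t ∈ Finset.range T, (z - y (t + 1)) ⬝ᵥ u (t + 1) ≤ logBarrier z - logBarrier (y 0) +
          ∑ t ∈ Finset.range T, (η * ((g (t + 1) - y (t + 1)) ⬝ᵥ (u (t + 1) - u t))
            - logBarrierDiv (y (t + 1)) (g t) - logBarrierDiv (g (t + 1)) (y (t + 1))) := by
  set U : ℕ → A → ℝ := fun t => ∑ τ ∈ Finset.Icc 1 t, u τ with hU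
  have hUs : ∀ t, U (t + 1) = U t + u (t + 1) := fun t =>
    Finset.sum_Icc_succ_top (by omega) _
  -- At `t = 0` the leader is taken to be `y 0` itself, which avoids appealing to uniqueness of the
  -- minimizer.
  have hex : ∀ t, ∃ g ∈ relintSimplex A,
      IsMaxOn (fun z => z ⬝ᵥ (η • U t) - logBarrier z) (relintSimplex A) g ∧
        (t = 0 → g = y 0) := by
    intro t
    rcases Nat.eq_zero_or_pos t with rfl | ht
    · refine ⟨y 0, h.mem 0, fun z hz => ?_, fun _ => rfl⟩
      have := h.init hz
      simp only [Set.mem_ofPred_eq] at this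
      simp [hU, this]
    · obtain ⟨g, hg, hm⟩ := exists_isMaxOn_barrier (η • U t)
      exact ⟨g, hg, hm, fun h0 => absurd h0 ht.ne'⟩
  choose g hgm hgmax hg0 using hex
  refine ⟨g, hg0 0 rfl, hgm, fun z hz T => ?_⟩
  -- Optimality of `g t` is tested at `y (t + 1)` and that of `y (t + 1)` at `g (t + 1)`; each test
  -- yields one divergence. The optimal values then telescope.
  have hstep : ∀ t, g t ⬝ᵥ (η • U t) - logBarrier (g t) ≥
      g (t + 1) ⬝ᵥ (η • U (t + 1)) - logBarrier (g (t + 1)) - η * (y (t + 1) ⬝ᵥ u (t + 1))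
        - (η * ((g (t + 1) - y (t + 1)) ⬝ᵥ (u (t + 1) - u t))
            - logBarrierDiv (y (t + 1)) (g t) - logBarrierDiv (g (t + 1)) (y (t + 1))) := by
    intro t
    have h1 := IsMaxOn.add_logBarrierDiv_le (hgm t) (hgmax t) (h.mem (t + 1))
    have h2 := IsMaxOn.add_logBarrierDiv_le (L := η • (u t + U t)) (h.mem (t + 1))
      (by simpa only [dotProduct_smul, smul_eq_mul] using h.step t) (hgm (t + 1))
    rw [hUs]
    simp only [dotProduct_smul, smul_eq_mul, dotProduct_add, dotProduct_sub,
      sub_dotProduct] at h1 h2 ⊢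
    linarith
  have htel : ∀ T, g T ⬝ᵥ (η • U T) - logBarrier (g T) ≤ - logBarrier (y 0) +
      η * ∑ t ∈ Finset.range T, y (t + 1) ⬝ᵥ u (t + 1) +
      ∑ t ∈ Finset.range T, (η * ((g (t + 1) - y (t + 1)) ⬝ᵥ (u (t + 1) - u t))
            - logBarrierDiv (y (t + 1)) (g t) - logBarrierDiv (g (t + 1)) (y (t + 1))) := by
    intro T
    induction T with
    | zero => simp [hU, hg0 0 rfl]
    | succ T ih =>
      rw [Finset.sum_range_succ, Finset.sum_range_succ]
      linarith [hstep T]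
  have h3 := hgmax T hz
  simp only [Set.mem_ofPred_eq] at h3
  have h4 : z ⬝ᵥ (η • U T) = η * ∑ t ∈ Finset.range T, z ⬝ᵥ u (t + 1) := by
    rw [dotProduct_smul, smul_eq_mul, hU]
    simp only [sum_Icc_one_eq_sum_range, dotProduct_sum]
  have h5 : ∑ t ∈ Finset.range T, (z - y (t + 1)) ⬝ᵥ u (t + 1) =
      ∑ t ∈ Finset.range T, z ⬝ᵥ u (t + 1) - ∑ t ∈ Finset.range T, y (t + 1) ⬝ᵥ u (t + 1) := by
    simp only [sub_dotProduct, Finset.sum_sub_distrib]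
  rw [h5]
  linarith [htel T]

end Barrier

/-! ### Perturbation of stationary distributions -/

section Stationary

variable {A : Type*} [Fintype A]

theorem IsStationary.sum_mul_eq {Q : Matrix A A ℝ} {p : A → ℝ} (h : IsStationary Q p) (b : A) :
    ∑ c, p c * Q c b = p b := by
  have := congrFun h.2 b
  simp only [Matrix.mulVec, dotProduct, Matrix.transpose_apply] at this
  rw [← this]
  exact Finset.sum_congr rfl fun c _ => mul_comm _ _

theorem IsStationary.pos {Q : Matrix A A ℝ} {p : A → ℝ} (h : IsStationary Q p)
    (hQ : ∀ a b, 0 < Q a b) (b : A) : 0 < p b := by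
  rw [← h.sum_mul_eq b]
  obtain ⟨a, -, ha⟩ : ∃ a ∈ Finset.univ, 0 < p a := by
    apply Finset.exists_lt_of_sum_lt
    simp [h.1.2]
  exact Finset.sum_pos' (fun c _ => mul_nonneg (h.1.1 c) (hQ c b).le)
    ⟨a, Finset.mem_univ a, mul_pos ha (hQ a b)⟩

theorem sum_abs_sub_le_two {p q : A → ℝ} (hp : p ∈ stdSimplex ℝ A) (hq : q ∈ stdSimplex ℝ A) :
    ∑ b, |p b - q b| ≤ 2 := by
  calc ∑ b, |p b - q b| ≤ ∑ b, (p b + q b) := Finset.sum_le_sum fun b _ =>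
        abs_le.mpr ⟨by linarith [hp.1 b, hq.1 b], by linarith [hp.1 b, hq.1 b]⟩
    _ = 2 := by rw [Finset.sum_add_distrib, hp.2, hq.2]; norm_num

variable [DecidableEq A]

/-- The minimum principle for a positive stochastic matrix killed at the state `a`. -/
theorem nonneg_of_sum_erase_le {Q : Matrix A A ℝ} (hQ : ∀ c, Q c ∈ relintSimplex A) (a : A)
    {ν : A → ℝ} (h : ∀ b, ∑ c ∈ Finset.univ.erase a, ν c * Q c b ≤ ν b) (b : A) : 0 ≤ ν b := by
  -- The negative part is dominated by its own image under the killed chain. Killing loses mass at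
  -- rate `Q c a > 0`, so summing over `b ≠ a` forces it to vanish off `a`, hence everywhere.
  have hneg : ∀ b, (ν b)⁻ ≤ ∑ c ∈ Finset.univ.erase a, (ν c)⁻ * Q c b := by
    intro b
    have h1 : -∑ c ∈ Finset.univ.erase a, (ν c)⁻ * Q c b
        ≤ ∑ c ∈ Finset.univ.erase a, ν c * Q c b := by
      rw [← Finset.sum_neg_distrib]
      refine Finset.sum_le_sum fun c _ => ?_
      have := neg_le_negPart (ν c)
      nlinarith [(hQ c).2 b]
    rw [negPart_def, sup_le_iff]
    exact ⟨by linarith [h b], Finset.sum_nonneg fun c _ =>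
      mul_nonneg (negPart_nonneg _) ((hQ c).2 b).le⟩
  have hrow : ∀ c, ∑ b ∈ Finset.univ.erase a, Q c b = 1 - Q c a := fun c => by
    rw [← (hQ c).1.2, ← Finset.add_sum_erase _ _ (Finset.mem_univ a)]; ring
  have hsum : ∑ b ∈ Finset.univ.erase a, (ν b)⁻
      ≤ ∑ c ∈ Finset.univ.erase a, (ν c)⁻ * (1 - Q c a) := by
    refine (Finset.sum_le_sum fun b _ => hneg b).trans_eq ?_
    rw [Finset.sum_comm]
    exact Finset.sum_congr rfl fun c _ => by rw [← Finset.mul_sum, hrow]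
  have hle : ∑ c ∈ Finset.univ.erase a, (ν c)⁻ * Q c a ≤ 0 := by
    simp_rw [mul_sub, mul_one, Finset.sum_sub_distrib] at hsum
    linarith
  have hzero : ∀ c ∈ Finset.univ.erase a, (ν c)⁻ = 0 := fun c hc => by
    have h0 := (Finset.sum_eq_zero_iff_of_nonneg fun c _ =>
      mul_nonneg (negPart_nonneg (ν c)) ((hQ c).2 a).le).mp
      (le_antisymm hle (Finset.sum_nonneg fun c _ =>
        mul_nonneg (negPart_nonneg _) ((hQ c).2 a).le)) c hc
    exact (mul_eq_zero.mp h0).resolve_right ((hQ c).2 a).ne'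
  have := hneg b
  rw [Finset.sum_eq_zero fun c hc => by rw [hzero c hc, zero_mul]] at this
  linarith [neg_le_negPart (ν b)]

/-- A multiplicative perturbation of a single row of a positive stochastic matrix moves the
stationary distribution by at most twice the size of the perturbation. -/
theorem sum_abs_sub_le_of_row {P P' : Matrix A A ℝ} (hP : ∀ c, P c ∈ relintSimplex A)
    (hP' : ∀ c, P' c ∈ relintSimplex A) {p p' : A → ℝ} (hp : IsStationary P p)
    (hp' : IsStationary P' p') (a : A) (heq : ∀ c, c ≠ a → P' c = P c) {ε : ℝ}
    (hε : ∀ b, |P' a b - P a b| ≤ ε * P a b) : ∑ b, |p' b - p b| ≤ 2 * ε := by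
  have ha : 0 < p a := hp.pos (fun c => (hP c).2) a
  have ha' : 0 < p' a := hp'.pos (fun c => (hP' c).2) a
  have e1 : ∀ b, ∑ c ∈ Finset.univ.erase a, p c * P c b = p b - p a * P a b := fun b => by
    rw [← hp.sum_mul_eq b, ← Finset.add_sum_erase _ _ (Finset.mem_univ a)]; ring
  have e2 : ∀ b, ∑ c ∈ Finset.univ.erase a, p' c * P c b = p' b - p' a * P' a b := fun b => by
    rw [← hp'.sum_mul_eq b, ← Finset.add_sum_erase _ _ (Finset.mem_univ a), add_sub_cancel_left]
    exact Finset.sum_congr rfl fun c hc => by rw [heq c (Finset.ne_of_mem_erase hc)]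
  have lin : ∀ (α β : ℝ) b, ∑ c ∈ Finset.univ.erase a, (α * p c + β * p' c) * P c b
      = α * (p b - p a * P a b) + β * (p' b - p' a * P' a b) := fun α β b => by
    rw [← e1, ← e2, Finset.mul_sum, Finset.mul_sum, ← Finset.sum_add_distrib]
    exact Finset.sum_congr rfl fun c _ => by ring
  have hpp : 0 < p a * p' a := mul_pos ha ha'
  -- Off row `a` the two chains agree, so in such a combination only the row `a` source terms
  -- differ. The factors `p' a` and `p a` align them up to `1 ± ε`, and the minimum principle
  -- applies.
  have up : ∀ b, 0 ≤ (1 + ε) * p' a * p b + -p a * p' b :=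
    nonneg_of_sum_erase_le hP a fun b => by
      rw [lin]
      have := mul_le_mul_of_nonneg_left (abs_le.mp (hε b)).2 hpp.le
      nlinarith
  have lo : ∀ b, 0 ≤ -((1 - ε) * p' a) * p b + p a * p' b :=
    nonneg_of_sum_erase_le hP a fun b => by
      rw [lin]
      have := mul_le_mul_of_nonneg_left (abs_le.mp (hε b)).1 hpp.le
      nlinarith
  have hab : ∀ b, |p a * p' b - p' a * p b| ≤ ε * p' a * p b := fun b =>
    abs_le.mpr ⟨by nlinarith [lo b], by nlinarith [up b]⟩
  have hsum : ∑ b, |p a * p' b - p' a * p b| ≤ ε * p' a := by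
    refine (Finset.sum_le_sum fun b _ => hab b).trans_eq ?_
    rw [← Finset.mul_sum, hp.1.2, mul_one]
  have hdiff : |p a - p' a| ≤ ε * p' a := by
    refine le_trans ?_ hsum
    refine le_trans (le_of_eq ?_) (Finset.abs_sum_le_sum_abs _ _)
    rw [Finset.sum_sub_distrib, ← Finset.mul_sum, ← Finset.mul_sum, hp.1.2, hp'.1.2, mul_one,
      mul_one]
  have hfin : p' a * ∑ b, |p' b - p b| ≤ p' a * (2 * ε) := by
    calc p' a * ∑ b, |p' b - p b|
        ≤ ∑ b, (|p a * p' b - p' a * p b| + |p a - p' a| * p' b) := by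
          rw [Finset.mul_sum]
          refine Finset.sum_le_sum fun b _ => ?_
          calc p' a * |p' b - p b|
              = |(p a * p' b - p' a * p b) - (p a - p' a) * p' b| := by
                rw [← abs_of_pos ha', ← abs_mul, abs_of_pos ha']; congr 1; ring
            _ ≤ _ := (abs_sub _ _).trans_eq (by rw [abs_mul (p a - p' a), abs_of_nonneg (hp'.1.1 b)])
      _ ≤ ε * p' a + ε * p' a := by
          rw [Finset.sum_add_distrib, ← Finset.mul_sum, hp'.1.2, mul_one]
          exact add_le_add hsum hdiff
      _ = _ := by ring
  exact le_of_mul_le_mul_left hfin ha'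

/-- Perturbation bound for the stationary distribution of a positive stochastic matrix. -/
theorem sum_abs_stationary_sub_le {P P' : Matrix A A ℝ} (hP : ∀ c, P c ∈ relintSimplex A)
    (hP' : ∀ c, P' c ∈ relintSimplex A) {p p' : A → ℝ} (hp : IsStationary P p)
    (hp' : IsStationary P' p') {e : A → ℝ}
    (he : ∀ a, 1 ≤ e a ∨ ∀ b, |P' a b - P a b| ≤ e a * P a b) :
    ∑ b, |p' b - p b| ≤ 2 * ∑ a, e a := by
  -- Rows are exchanged one at a time, through stationary distributions of the hybrid matrices.
  have key : ∀ S : Finset A, ∀ q, IsStationary (fun c => if c ∈ S then P' c else P c) q →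
      ∑ b, |q b - p b| ≤ 2 * ∑ a ∈ S, e a := by
    have hmem : ∀ (S : Finset A) c, (if c ∈ S then P' c else P c) ∈ relintSimplex A :=
      fun S c => by split_ifs; exacts [hP' c, hP c]
    intro S
    induction S using Finset.induction_on with
    | empty =>
      intro q hq
      -- With no row exchanged this is uniqueness of the stationary distribution: the row bound with
      -- `ε = 0`.
      simpa using sum_abs_sub_le_of_row hP hP hp (by simpa using hq)
        (Classical.choice (by
          by_contra hne
          rw [not_nonempty_iff] at hne
          simpa using hp.1.2)) (fun _ _ => rfl) (ε := 0) (by simp)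
    | insert a S haS ih =>
      intro q hq
      have : Nonempty A := ⟨a⟩
      obtain ⟨r, hr⟩ := exists_isStationary (fun c => if c ∈ S then P' c else P c)
        (fun c => (hmem S c).1)
      have h1 : ∑ b, |q b - r b| ≤ 2 * e a := by
        rcases he a with h | h
        · linarith [sum_abs_sub_le_two hq.1 hr.1]
        · refine sum_abs_sub_le_of_row (hmem S) (hmem (insert a S)) hr hq a (fun c hc => ?_) ?_
          · simp [hc]
          · simpa [haS] using h
      rw [Finset.sum_insert haS, mul_add]
      refine le_trans ?_ (add_le_add h1 (ih r hr))
      rw [← Finset.sum_add_distrib]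
      exact Finset.sum_le_sum fun b _ => abs_sub_le _ _ _
  exact key Finset.univ p' (by simpa using hp')

/-- Turns a small divergence into a small multiplicative change of each entry. Smallness is needed
because `r - 1 - log r` grows only linearly for large `r`; it forces `r < 2`. -/
theorem sq_sub_one_le_four_mul {r : ℝ} (hr : 0 < r) (h : 4 * (r - 1 - Real.log r) < 1) :
    (r - 1) ^ 2 ≤ 4 * (r - 1 - Real.log r) := by
  have hr2 : r < 2 := by
    by_contra! hge
    have h1 := Real.log_le_sub_one_of_pos (show 0 < r / 2 by linarith)
    rw [Real.log_div hr.ne' two_ne_zero] at h1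
    linarith [Real.log_two_lt_d9]
  rcases le_total 1 r with h1 | h1
  · have h2 : Real.log r ≤ (r - r⁻¹) / 2 := by
      -- Here `log r ≤ sinh (log r) = (r - r⁻¹) / 2`.
      have := Real.self_le_sinh_iff.mpr (Real.log_nonneg h1)
      rwa [Real.sinh_eq, Real.exp_neg, Real.exp_log hr] at this
    have h3 : (r - 1) ^ 2 ≤ 4 * (r - 1 - (r - r⁻¹) / 2) := by
      have : 4 * (r - 1 - (r - r⁻¹) / 2) = 2 * (r - 1) ^ 2 / r := by field_simp; ring
      rw [this, le_div_iff₀ hr]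
      nlinarith [sq_nonneg (r - 1)]
    linarith
  · have h2 : Real.log r ≤ (r - 1) - (r - 1) ^ 2 / 4 := by
      -- From `log r = 2 log √r ≤ 2 (√r - 1)`, the right side is at least `4 (1 - √r)²`.
      have h3 := Real.log_le_sub_one_of_pos (Real.sqrt_pos.mpr hr)
      rw [Real.log_sqrt hr.le] at h3
      have h4 := Real.sq_sqrt hr.le
      have h5 : √r ≤ 1 := Real.sqrt_le_one.mpr h1
      have h6 := Real.sqrt_nonneg r
      set s := √r
      have : (s ^ 2 - 1) ^ 2 ≤ 4 * (1 - s) ^ 2 := by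
        have : (s ^ 2 - 1) ^ 2 = (1 - s) ^ 2 * (1 + s) ^ 2 := by ring
        rw [this, mul_comm]
        exact mul_le_mul_of_nonneg_right (by nlinarith) (sq_nonneg _)
      rw [h4] at this
      nlinarith
    linarith

/-- The stationary distribution is stable with respect to the divergence of the rows. -/
theorem sum_abs_stationary_sub_le_sum_sqrt {P P' : Matrix A A ℝ}
    (hP : ∀ c, P c ∈ relintSimplex A)
    (hP' : ∀ c, P' c ∈ relintSimplex A) {p p' : A → ℝ} (hp : IsStationary P p)
    (hp' : IsStationary P' p') :
    ∑ b, |p' b - p b| ≤ 2 * ∑ a, √(4 * logBarrierDiv (P' a) (P a)) := by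
  refine sum_abs_stationary_sub_le hP hP' hp hp' fun a => ?_
  by_cases h1 : 1 ≤ √(4 * logBarrierDiv (P' a) (P a))
  · exact Or.inl h1
  refine Or.inr fun b => ?_
  have hlt : 4 * logBarrierDiv (P' a) (P a) < 1 := by
    by_contra! h
    exact h1 (Real.one_le_sqrt.mpr h)
  have hb := (hP a).2 b
  have hpos : ∀ b, 0 < P' a b / P a b := fun b => div_pos ((hP' a).2 b) ((hP a).2 b)
  have hle : P' a b / P a b - 1 - Real.log (P' a b / P a b) ≤ logBarrierDiv (P' a) (P a) :=
    Finset.single_le_sum (f := fun b => P' a b / P a b - 1 - Real.log (P' a b / P a b))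
      (fun b _ => sub_one_sub_log_nonneg (hpos b)) (Finset.mem_univ b)
  have hsq := sq_sub_one_le_four_mul (hpos b) (by linarith)
  have : |P' a b / P a b - 1| ≤ √(4 * logBarrierDiv (P' a) (P a)) :=
    Real.abs_le_sqrt (by linarith)
  calc |P' a b - P a b| = |P' a b / P a b - 1| * P a b := by
        rw [← abs_of_pos hb, ← abs_mul, abs_of_pos hb, sub_mul, div_mul_cancel₀ _ hb.ne', one_mul]
    _ ≤ _ := mul_le_mul_of_nonneg_right this hb.le

/-- The regret bound penalizes the two half-steps through the auxiliary iterates, which form the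
rows of `G`, so the path passes through a stationary distribution of `G`. The factor `Fintype.card
A` is Cauchy–Schwarz over the rows. -/
theorem sq_sum_abs_stationary_sub_le {P G P' : Matrix A A ℝ} [Nonempty A]
    (hP : ∀ c, P c ∈ relintSimplex A) (hG : ∀ c, G c ∈ relintSimplex A)
    (hP' : ∀ c, P' c ∈ relintSimplex A) {p p' : A → ℝ} (hp : IsStationary P p)
    (hp' : IsStationary P' p') :
    (∑ b, |p' b - p b|) ^ 2 ≤ 32 * Fintype.card A *
      ∑ a, (logBarrierDiv (P' a) (G a) + logBarrierDiv (G a) (P a)) := by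
  obtain ⟨q, hq⟩ := exists_isStationary G fun c => (hG c).1
  have h1 := sum_abs_stationary_sub_le_sum_sqrt hP hG hp hq
  have h2 := sum_abs_stationary_sub_le_sum_sqrt hG hP' hq hp'
  have hn : ∀ {X Y : Matrix A A ℝ}, (∀ c, X c ∈ relintSimplex A) → (∀ c, Y c ∈ relintSimplex A) →
      ∀ a, 0 ≤ 4 * logBarrierDiv (X a) (Y a) := fun hX hY a =>
    mul_nonneg (by norm_num) (logBarrierDiv_nonneg (hX a).2 (hY a).2)
  have h3 : ∑ b, |p' b - p b| ≤ 2 * ∑ a, (√(4 * logBarrierDiv (P' a) (G a))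
      + √(4 * logBarrierDiv (G a) (P a))) := by
    rw [Finset.sum_add_distrib, mul_add]
    refine le_trans ?_ (add_le_add h2 h1)
    rw [← Finset.sum_add_distrib]
    exact Finset.sum_le_sum fun b _ => abs_sub_le _ _ _
  refine (pow_le_pow_left₀ (Finset.sum_nonneg fun b _ => abs_nonneg _) h3 2).trans ?_
  rw [mul_pow]
  have h4 := sq_sum_le_card_mul_sum_sq (s := (Finset.univ : Finset A))
    (f := fun a => √(4 * logBarrierDiv (P' a) (G a)) + √(4 * logBarrierDiv (G a) (P a)))
  rw [Finset.card_univ] at h4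
  have h5 : ∑ a, (√(4 * logBarrierDiv (P' a) (G a)) + √(4 * logBarrierDiv (G a) (P a))) ^ 2
      ≤ 8 * ∑ a, (logBarrierDiv (P' a) (G a) + logBarrierDiv (G a) (P a)) := by
    rw [Finset.mul_sum]
    refine Finset.sum_le_sum fun a _ => (add_sq_le).trans_eq ?_
    rw [Real.sq_sqrt (hn hP' hG a), Real.sq_sqrt (hn hG hP a)]
    ring
  have h6 := mul_le_mul_of_nonneg_left h5 (Nat.cast_nonneg (α := ℝ) (Fintype.card A))
  nlinarith

end Stationary

/-! ### From the regret of the rows to swap regret -/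

section BlumMansour

variable {A : Type*} [Fintype A]

/-- The regret of optimistic follow-the-regularized-leader against every point of the relative
interior is bounded by the variation of the utilities, with the movement of the iterates as a
negative term. -/
theorem IsOFTRLLogBar.exists_regret_le_variation [Nonempty A] {η : ℝ} {u y : ℕ → A → ℝ}
    (h : IsOFTRLLogBar η u y) (hη : 0 ≤ η) {w : ℕ → ℝ}
    (hw : ∀ t b, |u (t + 1) b - u t b| ≤ w t) (hηw : ∀ t, η * w t ≤ 1 / 4) :
    ∃ g : ℕ → A → ℝ, (∀ t, g t ∈ relintSimplex A) ∧ ∀ z ∈ relintSimplex A, ∀ T,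
      η * ∑ t ∈ Finset.range T, (z - y (t + 1)) ⬝ᵥ u (t + 1) ≤ logBarrier z - logBarrier (y 0) +
        ∑ t ∈ Finset.range T, (4 * η ^ 2 * w t ^ 2
          - (logBarrierDiv (y (t + 1)) (g t) + logBarrierDiv (g t) (y t)) / 2) := by
  obtain ⟨g, hg0, hg, hreg⟩ := h.exists_regret_le
  refine ⟨g, hg, fun z hz T => (hreg z hz T).trans (add_le_add_right ?_ _)⟩
  -- Shifting the index is free because `g 0 = y 0` makes the initial divergence zero.
  have hshift : ∑ t ∈ Finset.range T, logBarrierDiv (g t) (y t)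
      ≤ ∑ t ∈ Finset.range T, logBarrierDiv (g (t + 1)) (y (t + 1)) := by
    have h1 := Finset.sum_range_succ' (fun t => logBarrierDiv (g t) (y t)) T
    rw [Finset.sum_range_succ, hg0, logBarrierDiv_self (h.mem 0).2] at h1
    linarith [logBarrierDiv_nonneg (hg T).2 (h.mem T).2]
  have hstep : ∑ t ∈ Finset.range T, (η * ((g (t + 1) - y (t + 1)) ⬝ᵥ (u (t + 1) - u t))
        - logBarrierDiv (y (t + 1)) (g t) - logBarrierDiv (g (t + 1)) (y (t + 1))) ≤
      ∑ t ∈ Finset.range T, (4 * η ^ 2 * w t ^ 2 - logBarrierDiv (y (t + 1)) (g t) / 2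
        - logBarrierDiv (g (t + 1)) (y (t + 1)) / 2) := by
    refine Finset.sum_le_sum fun t _ => ?_
    have h2 := mul_sub_dotProduct_le (d := u (t + 1) - u t) (hg (t + 1)).2 (h.mem (t + 1)) hη
      (hw t) (hηw t)
    linarith [logBarrierDiv_nonneg (h.mem (t + 1)).2 (hg t).2]
  refine hstep.trans ?_
  simp only [add_div, Finset.sum_sub_distrib, Finset.sum_add_distrib, ← Finset.sum_div]
  linarith

theorem sub_dotProduct_le_two_mul {z y u : A → ℝ} (hz : z ∈ stdSimplex ℝ A)
    (hy : y ∈ stdSimplex ℝ A) {β : ℝ} (hu : ∀ b, |u b| ≤ β) : (z - y) ⬝ᵥ u ≤ 2 * β := by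
  have h1 : z ⬝ᵥ u ≤ β := by
    calc z ⬝ᵥ u ≤ ∑ b, z b * β := Finset.sum_le_sum fun b _ =>
          mul_le_mul_of_nonneg_left ((le_abs_self _).trans (hu b)) (hz.1 b)
      _ = β := by rw [← Finset.sum_mul, hz.2, one_mul]
  have h2 : -β ≤ y ⬝ᵥ u := by
    calc -β = ∑ b, y b * -β := by rw [← Finset.sum_mul, hy.2, one_mul]
      _ ≤ y ⬝ᵥ u := Finset.sum_le_sum fun b _ =>
          mul_le_mul_of_nonneg_left (abs_le.mp (hu b)).1 (hy.1 b)
  rw [sub_dotProduct]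
  linarith

/-- The regret bound against arbitrary points of the simplex, at the price of a logarithmic
term. -/
theorem IsOFTRLLogBar.exists_regret_le_log [Nonempty A] {η : ℝ} {u y : ℕ → A → ℝ}
    (h : IsOFTRLLogBar η u y) (hη : 0 ≤ η) {w β : ℕ → ℝ}
    (hw : ∀ t b, |u (t + 1) b - u t b| ≤ w t) (hηw : ∀ t, η * w t ≤ 1 / 4)
    (hu : ∀ t b, |u t b| ≤ β t) :
    ∃ g : ℕ → A → ℝ, (∀ t, g t ∈ relintSimplex A) ∧ ∀ z ∈ stdSimplex ℝ A, ∀ T, 1 ≤ T →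
      η * ∑ t ∈ Finset.range T, (z - y (t + 1)) ⬝ᵥ u (t + 1) ≤ Fintype.card A * Real.log T +
        η * (2 / T * ∑ t ∈ Finset.range T, β (t + 1)) +
        ∑ t ∈ Finset.range T, (4 * η ^ 2 * w t ^ 2
          - (logBarrierDiv (y (t + 1)) (g t) + logBarrierDiv (g t) (y t)) / 2) := by
  obtain ⟨g, hg, hreg⟩ := h.exists_regret_le_variation hη hw hηw
  refine ⟨g, hg, fun z hz T hT => ?_⟩
  have hT0 : (0 : ℝ) < T := by exact_mod_cast hT
  have hT1 : (1 : ℝ) ≤ T := by exact_mod_cast hT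
  have hi1 : (T : ℝ)⁻¹ ≤ 1 := inv_le_one_of_one_le₀ hT1
  have hi0 : 0 < (T : ℝ)⁻¹ := inv_pos.mpr hT0
  -- The barrier may be infinite at `z`. Moving a fraction `1 / T` towards `y 0` keeps every
  -- coordinate above `y 0 b / T`, at barrier cost `log T` per coordinate.
  set z' : A → ℝ := y 0 + (1 - (T : ℝ)⁻¹) • (z - y 0) with hz'
  have hz'm : z' ∈ relintSimplex A :=
    add_smul_sub_mem_relintSimplex (h.mem 0) hz (by linarith) (by linarith)
  have hbar : logBarrier z' - logBarrier (y 0) ≤ Fintype.card A * Real.log T := by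
    have hb : ∀ b, Real.log (y 0 b) - Real.log T ≤ Real.log (z' b) := fun b => by
      rw [← Real.log_div ((h.mem 0).2 b).ne' hT0.ne']
      refine Real.log_le_log (div_pos ((h.mem 0).2 b) hT0) ?_
      have : z' b = y 0 b / T + (1 - (T : ℝ)⁻¹) * z b := by
        simp only [hz', Pi.add_apply, Pi.smul_apply, Pi.sub_apply, smul_eq_mul]
        ring
      rw [this]
      exact le_add_of_nonneg_right (mul_nonneg (by linarith) (hz.1 b))
    have := Finset.sum_le_sum fun b (_ : b ∈ Finset.univ) => hb b
    rw [Finset.sum_sub_distrib, Finset.sum_const, Finset.card_univ, nsmul_eq_mul] at this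
    simp only [logBarrier]
    linarith
  have hloss : ∑ t ∈ Finset.range T, (z - y (t + 1)) ⬝ᵥ u (t + 1) ≤
      ∑ t ∈ Finset.range T, (z' - y (t + 1)) ⬝ᵥ u (t + 1)
        + 2 / T * ∑ t ∈ Finset.range T, β (t + 1) := by
    rw [Finset.mul_sum, ← Finset.sum_add_distrib]
    refine Finset.sum_le_sum fun t _ => ?_
    have h1 := mul_le_mul_of_nonneg_left
      (sub_dotProduct_le_two_mul hz (h.mem 0).1 (hu (t + 1))) hi0.le
    have h2 : z - y (t + 1) = (z' - y (t + 1)) + (T : ℝ)⁻¹ • (z - y 0) := by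
      rw [hz', sub_smul, one_smul]; abel
    rw [h2, add_dotProduct, smul_dotProduct, smul_eq_mul]
    refine add_le_add_right (h1.trans_eq ?_) _
    ring
  have := mul_le_mul_of_nonneg_left hloss hη
  linarith [hreg z' hz'm T]

theorem sum_sq_le_of_mem_stdSimplex {x : A → ℝ} (hx : x ∈ stdSimplex ℝ A) :
    ∑ a, x a ^ 2 ≤ 1 := by
  have := Finset.sum_sq_le_sq_sum_of_nonneg (s := Finset.univ) (f := x) fun a _ => hx.1 a
  rwa [hx.2, one_pow] at this

theorem le_one_of_mem_stdSimplex {x : A → ℝ} (hx : x ∈ stdSimplex ℝ A) (a : A) : x a ≤ 1 := by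
  rw [← hx.2]
  exact Finset.single_le_sum (fun b _ => hx.1 b) (Finset.mem_univ a)

theorem cumUtility_eq_of_mem [DecidableEq A] {φ : (A → ℝ) → (A → ℝ)}
    (hφ : φ ∈ swapTransformations A) (x u : ℕ → A → ℝ) (T : ℕ) :
    cumUtility φ x u T = ∑ a, ∑ t ∈ Finset.range T,
      φ (Pi.single a 1) ⬝ᵥ (x (t + 1) a • u (t + 1)) := by
  have h1 : ∀ y : A → ℝ, φ y = ∑ a, y a • φ (Pi.single a 1) := by
    intro y
    have := (hφ.1.mk' φ).pi_apply_eq_sum_univ y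
    simp only [IsLinearMap.mk'_apply] at this
    rw [this]
    refine Finset.sum_congr rfl fun a _ => ?_
    congr 2
    ext b
    simp [Pi.single_apply, eq_comm]
  rw [cumUtility, sum_Icc_one_eq_sum_range, Finset.sum_comm]
  refine Finset.sum_congr rfl fun t _ => ?_
  rw [h1, sum_dotProduct]
  simp only [smul_dotProduct, dotProduct_smul]

/-- Stationarity lets the played strategy be read as the mixture of the rows, matching the
decomposition of `φ (x t)` over vertices. -/
theorem cumUtility_id_eq {Q : ℕ → Matrix A A ℝ} {x : ℕ → A → ℝ}
    (hQ : ∀ t, IsStationary (Q t) (x t)) (u : ℕ → A → ℝ) (T : ℕ) :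
    cumUtility id x u T = ∑ a, ∑ t ∈ Finset.range T,
      Q (t + 1) a ⬝ᵥ (x (t + 1) a • u (t + 1)) := by
  rw [cumUtility, sum_Icc_one_eq_sum_range, Finset.sum_comm]
  refine Finset.sum_congr rfl fun t _ => ?_
  have h1 : x (t + 1) = ∑ a, x (t + 1) a • Q (t + 1) a := by
    ext b
    simp [Finset.sum_apply, (hQ (t + 1)).sum_mul_eq b]
  conv_lhs => rw [id, h1, sum_dotProduct]
  simp only [smul_dotProduct, dotProduct_smul]

theorem swapRegret_nonneg [Nonempty A] (x u : ℕ → A → ℝ) (T : ℕ) : 0 ≤ swapRegret x u T := by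
  obtain ⟨v, hv⟩ := exists_isGreatest_cumUtility x u T
  exact sub_nonneg.mpr (le_csSup ⟨v, hv.2⟩ ⟨id, ⟨⟨fun _ _ => rfl, fun _ _ => rfl⟩,
    Set.mapsTo_id _⟩, rfl⟩)

/-- The swap regret of the Blum–Mansour algorithm is bounded by the variation of the utilities, with
the movement of the strategies as a negative term. -/
theorem IsBMOFTRLLogBar.swapRegret_le [Nonempty A] {η : ℝ} {u x : ℕ → A → ℝ}
    (h : IsBMOFTRLLogBar η u x) (hη : 0 < η) {δ : ℕ → ℝ} (hu : ∀ t b, |u t b| ≤ 1)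
    (hδ : ∀ t b, |u (t + 1) b - u t b| ≤ δ t) (hηδ : ∀ t, η * (δ t + 1) ≤ 1 / 4)
    {T : ℕ} (hT : 1 ≤ T) :
    η * swapRegret x u T ≤ (Fintype.card A : ℝ) ^ 2 * Real.log T + 2 * η +
      ∑ t ∈ Finset.range T, (8 * η ^ 2 * δ t ^ 2 +
        (8 * η ^ 2 - 1 / (64 * Fintype.card A)) * (∑ b, |x (t + 1) b - x t b|) ^ 2) := by
  classical
  obtain ⟨Q, hQ, hst⟩ := h
  have hx : ∀ t, x t ∈ stdSimplex ℝ A := fun t => (hst t).1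
  have hQm : ∀ t a, Q t a ∈ relintSimplex A := fun t a => (hQ a).mem t
  have hT0 : (T : ℝ) ≠ 0 := by exact_mod_cast (by omega : T ≠ 0)
  have hm : (0 : ℝ) < Fintype.card A := by exact_mod_cast Fintype.card_pos
  have hδ0 : ∀ t, 0 ≤ δ t := fun t => (abs_nonneg _).trans (hδ t (Classical.arbitrary A))
  -- The weight `x (t + 1) a` is kept on `δ t`: as `∑ a, x a ^ 2 ≤ 1`, summing the squared
  -- variations over the rows costs no factor of the number of actions.
  set w : A → ℕ → ℝ := fun a t => x (t + 1) a * δ t + |x (t + 1) a - x t a| with hwdef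
  have hw : ∀ a t b, |x (t + 1) a * u (t + 1) b - x t a * u t b| ≤ w a t := fun a t b => by
    have : x (t + 1) a * u (t + 1) b - x t a * u t b
        = x (t + 1) a * (u (t + 1) b - u t b) + (x (t + 1) a - x t a) * u t b := by ring
    rw [this]
    refine (abs_add_le _ _).trans (add_le_add ?_ ?_)
    · rw [abs_mul, abs_of_nonneg ((hx _).1 a)]
      exact mul_le_mul_of_nonneg_left (hδ t b) ((hx _).1 a)
    · rw [abs_mul]
      exact mul_le_of_le_one_right (abs_nonneg _) (hu t b)
  have hηw : ∀ a t, η * w a t ≤ 1 / 4 := fun a t => by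
    refine le_trans (mul_le_mul_of_nonneg_left ?_ hη.le) (hηδ t)
    have h1 := le_one_of_mem_stdSimplex (hx (t + 1)) a
    have h2 := le_one_of_mem_stdSimplex (hx t) a
    have h3 := (hx (t + 1)).1 a
    have h4 := (hx t).1 a
    exact add_le_add (mul_le_of_le_one_left (hδ0 t) h1)
      (abs_le.mpr ⟨by linarith, by linarith⟩)
  choose g hg hreg using fun a => (hQ a).exists_regret_le_log hη.le (w := w a)
    (β := fun t => x t a) (hw a) (hηw a) (fun t b => by
      rw [Pi.smul_apply, smul_eq_mul, abs_mul, abs_of_nonneg ((hx t).1 a)]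
      exact mul_le_of_le_one_right ((hx t).1 a) (hu t b))
  have hφ : ∀ φ ∈ swapTransformations A, η * (cumUtility φ x u T - cumUtility id x u T) ≤
      (Fintype.card A : ℝ) ^ 2 * Real.log T + 2 * η +
      ∑ t ∈ Finset.range T, (8 * η ^ 2 * δ t ^ 2 +
        (8 * η ^ 2 - 1 / (64 * Fintype.card A)) * (∑ b, |x (t + 1) b - x t b|) ^ 2) := by
    intro φ hφ
    rw [cumUtility_eq_of_mem hφ, cumUtility_id_eq hst, ← Finset.sum_sub_distrib, Finset.mul_sum]
    have h1 := Finset.sum_le_sum fun a (_ : a ∈ Finset.univ) =>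
      hreg a (φ (Pi.single a 1)) (hφ.2 (single_mem_stdSimplex ℝ a)) T hT
    have h2 : ∑ a : A, (Fintype.card A * Real.log T +
        η * (2 / T * ∑ t ∈ Finset.range T, x (t + 1) a))
        = (Fintype.card A : ℝ) ^ 2 * Real.log T + 2 * η := by
      rw [Finset.sum_add_distrib, Finset.sum_const, Finset.card_univ, nsmul_eq_mul,
        ← Finset.mul_sum, ← Finset.mul_sum, Finset.sum_comm,
        Finset.sum_congr rfl fun t _ => (hx (t + 1)).2, Finset.sum_const, Finset.card_range,
        nsmul_eq_mul]
      field_simp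
    rw [Finset.sum_add_distrib, h2, Finset.sum_comm (t := Finset.range T)] at h1
    simp only [sub_dotProduct, Finset.sum_sub_distrib] at h1 ⊢
    refine h1.trans (add_le_add_right ?_ _)
    rw [← Finset.sum_sub_distrib]
    refine Finset.sum_le_sum fun t _ => ?_
    have h3 := sq_sum_abs_stationary_sub_le (hQm t) (fun a => hg a t) (hQm (t + 1)) (hst t)
      (hst (t + 1))
    have h4 : ∑ a, w a t ^ 2 ≤ 2 * δ t ^ 2 + 2 * (∑ b, |x (t + 1) b - x t b|) ^ 2 := by
      calc ∑ a, w a t ^ 2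
          ≤ ∑ a, (2 * δ t ^ 2 * x (t + 1) a ^ 2 + 2 * |x (t + 1) a - x t a| ^ 2) :=
            Finset.sum_le_sum fun a _ => add_sq_le.trans_eq (by ring)
        _ ≤ _ := by
            rw [Finset.sum_add_distrib, ← Finset.mul_sum, ← Finset.mul_sum]
            refine add_le_add ?_ (mul_le_mul_of_nonneg_left
              (Finset.sum_sq_le_sq_sum_of_nonneg fun a _ => abs_nonneg _) zero_le_two)
            exact mul_le_of_le_one_right (by positivity)
              (sum_sq_le_of_mem_stdSimplex (hx (t + 1)))
    have h5 : 1 / (64 * Fintype.card A) * (∑ b, |x (t + 1) b - x t b|) ^ 2 ≤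
        (∑ a, (logBarrierDiv (Q (t + 1) a) (g a t) + logBarrierDiv (g a t) (Q t a))) / 2 := by
      rw [one_div_mul_eq_div, div_le_div_iff₀ (by positivity) two_pos]
      linarith
    have h6 := mul_le_mul_of_nonneg_left h4 (by positivity : 0 ≤ 4 * η ^ 2)
    rw [← Finset.mul_sum, ← Finset.sum_div]
    linarith
  obtain ⟨v, hv⟩ := exists_isGreatest_cumUtility x u T
  obtain ⟨φ, hφm, hφv⟩ := hv.1
  have hs : swapRegret x u T = cumUtility φ x u T - cumUtility id x u T := by
    rw [swapRegret, phiRegret, hv.csSup_eq, ← hφv]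
  rw [hs]
  exact hφ φ hφm

end BlumMansour

/-! ### Total variation of product distributions -/

section ProductDistributions

variable {ι : Type*} [Fintype ι] [DecidableEq ι] {A : ι → Type*} [∀ i, Fintype (A i)]

theorem sum_prod_eq_prod_sum (f : ∀ i, A i → ℝ) :
    ∑ a : ∀ i, A i, ∏ i, f i (a i) = ∏ i, ∑ b, f i b := by
  rw [Finset.prod_univ_sum, Fintype.piFinset_univ]

/-- The `ℓ₁` distance of product distributions is at most the sum of the `ℓ₁` distances of their
factors. -/
theorem sum_abs_prod_sub_prod_le {y y' : ∀ i, A i → ℝ} (hy : ∀ i, y i ∈ stdSimplex ℝ (A i))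
    (hy' : ∀ i, y' i ∈ stdSimplex ℝ (A i)) :
    ∑ a : ∀ i, A i, |∏ i, y' i (a i) - ∏ i, y i (a i)| ≤ ∑ i, ∑ b, |y' i b - y i b| := by
  have key : ∀ S : Finset ι, ∑ a : ∀ i, A i,
      |∏ i, (if i ∈ S then y' i else y i) (a i) - ∏ i, y i (a i)|
        ≤ ∑ i ∈ S, ∑ b, |y' i b - y i b| := by
    intro S
    induction S using Finset.induction_on with
    | empty => simp
    | insert k S hk ih =>
      have hz : ∀ i, (if i ∈ S then y' i else y i) ∈ stdSimplex ℝ (A i) := fun i => by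
        split_ifs; exacts [hy' i, hy i]
      -- Replacing one factor changes the product by a product again, with `|y' k - y k|` in
      -- position `k`; its total sum then factorizes.
      have hdiff : ∀ a : ∀ i, A i, |∏ i, (if i ∈ insert k S then y' i else y i) (a i)
          - ∏ i, (if i ∈ S then y' i else y i) (a i)|
          = ∏ i, Function.update (fun i => if i ∈ S then y' i else y i) k
              (fun b => |y' k b - y k b|) i (a i) := by
        intro a
        have hrest : ∏ i ∈ Finset.univ.erase k, (if i ∈ insert k S then y' i else y i) (a i)
            = ∏ i ∈ Finset.univ.erase k, (if i ∈ S then y' i else y i) (a i) :=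
          Finset.prod_congr rfl fun i hi => by simp [Finset.ne_of_mem_erase hi]
        have hrest' : ∏ i ∈ Finset.univ.erase k,
            Function.update (fun i => if i ∈ S then y' i else y i) k
              (fun b => |y' k b - y k b|) i (a i)
            = ∏ i ∈ Finset.univ.erase k, (if i ∈ S then y' i else y i) (a i) :=
          Finset.prod_congr rfl fun i hi => by
            rw [Function.update_of_ne (Finset.ne_of_mem_erase hi)]
        rw [← Finset.mul_prod_erase _ _ (Finset.mem_univ k),
          ← Finset.mul_prod_erase _ _ (Finset.mem_univ k),
          ← Finset.mul_prod_erase _ _ (Finset.mem_univ k), hrest, hrest', ← sub_mul, abs_mul,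
          abs_of_nonneg (Finset.prod_nonneg fun i _ => (hz i).1 (a i)), Function.update_self]
        simp [hk]
      have hstep : ∑ a : ∀ i, A i, |∏ i, (if i ∈ insert k S then y' i else y i) (a i)
          - ∏ i, (if i ∈ S then y' i else y i) (a i)| = ∑ b, |y' k b - y k b| := by
        simp_rw [hdiff]
        rw [sum_prod_eq_prod_sum, ← Finset.mul_prod_erase _ _ (Finset.mem_univ k),
          Function.update_self, Finset.prod_eq_one, mul_one]
        intro i hi
        rw [Function.update_of_ne (Finset.ne_of_mem_erase hi)]
        exact (hz i).2
      rw [Finset.sum_insert hk]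
      refine le_trans ?_ (add_le_add hstep.le ih)
      rw [← Finset.sum_add_distrib]
      exact Finset.sum_le_sum fun a _ => abs_sub_le _ _ _
  simpa using key Finset.univ

end ProductDistributions

/-! ### Utility vectors and the regret of one player in the game -/

section Game

variable {n : ℕ} {A : Fin n → Type*} [∀ i, Fintype (A i)] [∀ i, DecidableEq (A i)]

/-- Fixing action `b` is playing a point mass, so bounds for full product distributions apply. -/
theorem utilityVector_eq_sum (i : Fin n) (v : (∀ j, A j) → ℝ) (x : ∀ j, A j → ℝ) (b : A i) :
    utilityVector i v x b =
      ∑ a : ∀ j, A j, v a * ∏ j, Function.update x i (Pi.single b 1) j (a j) := by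
  rw [utilityVector, Finset.sum_filter]
  refine Finset.sum_congr rfl fun a _ => ?_
  rw [← Finset.mul_prod_erase _ _ (Finset.mem_univ i), Function.update_self]
  split_ifs with h
  · rw [h, Pi.single_eq_same, one_mul]
    congr 1
    exact Finset.prod_congr rfl fun j hj => by
      rw [Function.update_of_ne (Finset.ne_of_mem_erase hj)]
  · simp [Pi.single_eq_of_ne h]

theorem update_single_mem_stdSimplex {x : ∀ j, A j → ℝ} (hx : ∀ j, x j ∈ stdSimplex ℝ (A j))
    (i : Fin n) (b : A i) (j : Fin n) :
    Function.update x i (Pi.single b 1) j ∈ stdSimplex ℝ (A j) := by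
  rcases eq_or_ne j i with rfl | h
  · rw [Function.update_self]; exact single_mem_stdSimplex ℝ b
  · rw [Function.update_of_ne h]; exact hx j

theorem abs_utilityVector_le_one {v : (∀ j, A j) → ℝ} (hv : ∀ a, |v a| ≤ 1)
    {x : ∀ j, A j → ℝ} (hx : ∀ j, x j ∈ stdSimplex ℝ (A j)) (i : Fin n) (b : A i) :
    |utilityVector i v x b| ≤ 1 := by
  have hm := update_single_mem_stdSimplex hx i b
  rw [utilityVector_eq_sum]
  calc |∑ a : ∀ j, A j, v a * ∏ j, Function.update x i (Pi.single b 1) j (a j)|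
      ≤ ∑ a : ∀ j, A j, ∏ j, Function.update x i (Pi.single b 1) j (a j) := by
        refine (Finset.abs_sum_le_sum_abs _ _).trans (Finset.sum_le_sum fun a _ => ?_)
        have h0 : 0 ≤ ∏ j, Function.update x i (Pi.single b 1) j (a j) :=
          Finset.prod_nonneg fun j _ => (hm j).1 (a j)
        rw [abs_mul, abs_of_nonneg h0]
        exact mul_le_of_le_one_left h0 (hv a)
    _ = 1 := by
        rw [sum_prod_eq_prod_sum]
        exact Finset.prod_eq_one fun j _ => (hm j).2

/-- The utility vector of a player is Lipschitz in the strategies of the other players. -/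
theorem abs_utilityVector_sub_le {v : (∀ j, A j) → ℝ} (hv : ∀ a, |v a| ≤ 1)
    {x x' : ∀ j, A j → ℝ} (hx : ∀ j, x j ∈ stdSimplex ℝ (A j))
    (hx' : ∀ j, x' j ∈ stdSimplex ℝ (A j)) (i : Fin n) (b : A i) :
    |utilityVector i v x' b - utilityVector i v x b| ≤
      ∑ j ∈ Finset.univ.erase i, ∑ c, |x' j c - x j c| := by
  rw [utilityVector_eq_sum, utilityVector_eq_sum, ← Finset.sum_sub_distrib]
  calc |∑ a : ∀ j, A j, (v a * ∏ j, Function.update x' i (Pi.single b 1) j (a j)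
        - v a * ∏ j, Function.update x i (Pi.single b 1) j (a j))|
      ≤ ∑ a : ∀ j, A j, |∏ j, Function.update x' i (Pi.single b 1) j (a j)
        - ∏ j, Function.update x i (Pi.single b 1) j (a j)| := by
        refine (Finset.abs_sum_le_sum_abs _ _).trans (Finset.sum_le_sum fun a _ => ?_)
        rw [← mul_sub, abs_mul]
        exact mul_le_of_le_one_left (abs_nonneg _) (hv a)
    _ ≤ _ := sum_abs_prod_sub_prod_le (update_single_mem_stdSimplex hx i b)
        (update_single_mem_stdSimplex hx' i b)
    _ = _ := by
        rw [← Finset.add_sum_erase _ _ (Finset.mem_univ i), Function.update_self,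
          Function.update_self]
        simp only [sub_self, abs_zero, Finset.sum_const_zero, zero_add]
        exact Finset.sum_congr rfl fun j hj => by
          rw [Function.update_of_ne (Finset.ne_of_mem_erase hj),
            Function.update_of_ne (Finset.ne_of_mem_erase hj)]

/-- The second-order path length of the strategies of one player over the times `0, …, T`. -/
noncomputable def pathLength {A : Type*} [Fintype A] (x : ℕ → A → ℝ) (T : ℕ) : ℝ :=
  ∑ t ∈ Finset.range T, (∑ b, |x (t + 1) b - x t b|) ^ 2

theorem pathLength_nonneg {A : Type*} [Fintype A] (x : ℕ → A → ℝ) (T : ℕ) :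
    0 ≤ pathLength x T :=
  Finset.sum_nonneg fun _ _ => sq_nonneg _

/-- The regret of one player in terms of the path lengths of all players. -/
theorem IsBMOFTRLPlay.swapRegret_le (hn : 2 ≤ n) [∀ i, Nonempty (A i)]
    {v : Fin n → (∀ j, A j) → ℝ} (hv : ∀ i a, |v i a| ≤ 1) {η : ℝ} (hη : 0 < η)
    (hηn : η * (2 * ((n : ℝ) - 1) + 1) ≤ 1 / 4) {x : ℕ → ∀ i, A i → ℝ}
    (hx : IsBMOFTRLPlay v η x) (i : Fin n) {T : ℕ} (hT : 1 ≤ T) :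
    η * swapRegret (fun t => x t i) (fun t => utilityVector i (v i) (x t)) T ≤
      (Fintype.card (A i) : ℝ) ^ 2 * Real.log T + 2 * η +
      8 * η ^ 2 * (((n : ℝ) - 1) *
        ((∑ j, pathLength (fun t => x t j) T) - pathLength (fun t => x t i) T)) +
      (8 * η ^ 2 - 1 / (64 * Fintype.card (A i))) * pathLength (fun t => x t i) T := by
  have hmem : ∀ t j, x t j ∈ stdSimplex ℝ (A j) := fun t j => by
    obtain ⟨Q, -, hQ⟩ := hx j
    exact (hQ t).1
  have hcard : (((Finset.univ.erase i).card : ℕ) : ℝ) = (n : ℝ) - 1 := by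
    rw [Finset.card_erase_of_mem (Finset.mem_univ i), Finset.card_univ, Fintype.card_fin,
      Nat.cast_sub (by omega), Nat.cast_one]
  set δ : ℕ → ℝ := fun t => ∑ j ∈ Finset.univ.erase i, ∑ c, |x (t + 1) j c - x t j c| with hδ
  have hδ2 : ∀ t, δ t ≤ 2 * ((n : ℝ) - 1) := fun t => by
    refine (Finset.sum_le_card_nsmul _ _ 2 fun j _ =>
      sum_abs_sub_le_two (hmem (t + 1) j) (hmem t j)).trans_eq ?_
    rw [nsmul_eq_mul, hcard, mul_comm]
  have h1 := (hx i).swapRegret_le hη (δ := δ)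
    (fun t b => abs_utilityVector_le_one (hv i) (hmem t) i b)
    (fun t b => abs_utilityVector_sub_le (hv i) (hmem t) (hmem (t + 1)) i b)
    (fun t => (mul_le_mul_of_nonneg_left (by linarith [hδ2 t]) hη.le).trans hηn) hT
  rw [Finset.sum_add_distrib, ← Finset.mul_sum, ← Finset.mul_sum] at h1
  have h2 : ∑ t ∈ Finset.range T, δ t ^ 2 ≤ ((n : ℝ) - 1) *
      ((∑ j, pathLength (fun t => x t j) T) - pathLength (fun t => x t i) T) := by
    have h3 : (∑ j, pathLength (fun t => x t j) T) - pathLength (fun t => x t i) T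
        = ∑ t ∈ Finset.range T, ∑ j ∈ Finset.univ.erase i,
          (∑ c, |x (t + 1) j c - x t j c|) ^ 2 := by
      rw [← Finset.add_sum_erase _ _ (Finset.mem_univ i), add_sub_cancel_left, Finset.sum_comm]
      rfl
    rw [h3, Finset.mul_sum]
    refine Finset.sum_le_sum fun t _ => ?_
    rw [← hcard]
    exact sq_sum_le_card_mul_sum_sq
  have h3 := mul_le_mul_of_nonneg_left h2 (by positivity : 0 ≤ 8 * η ^ 2)
  simp only [pathLength] at h3 ⊢
  linarith

end Game

end LogSwap

/-! ### Path length bound over all players and conclusion -/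

theorem mainTheorem2 {n : ℕ} (hn : 2 ≤ n)
    {A : Fin n → Type*} [∀ i, Fintype (A i)] [∀ i, DecidableEq (A i)]
    (hA : ∀ i, 2 ≤ Fintype.card (A i))
    (v : Fin n → (∀ j, A j) → ℝ) (hv : ∀ i a, v i a ∈ Set.Icc (-1 : ℝ) 1)
    (x : ℕ → ∀ i, A i → ℝ)
    (hx : LogSwap.IsBMOFTRLPlay v
      (1 / (128 * ((n : ℝ) - 1) * ⨆ j, √(Fintype.card (A j) : ℝ))) x)
    (i : Fin n) (T : ℕ) (hT : 2 ≤ T) :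
    LogSwap.swapRegret (fun t => x t i) (fun t => LogSwap.utilityVector i (v i) (x t)) T ≤
      256 * (⨆ j, √(Fintype.card (A j) : ℝ)) *
        (((n : ℝ) - 1) * (Fintype.card (A i) : ℝ) ^ 2 + ∑ j, (Fintype.card (A j) : ℝ) ^ 2) *
          Real.log T := by
  have hne : ∀ j, Nonempty (A j) := fun j => Fintype.card_pos_iff.mp (by linarith [hA j])
  have hA' : ∀ j, (2 : ℝ) ≤ Fintype.card (A j) := fun j => by exact_mod_cast hA j
  have hle : ∀ j, √(Fintype.card (A j) : ℝ) ≤ ⨆ j, √(Fintype.card (A j) : ℝ) := fun j =>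
    le_ciSup (f := fun j => √(Fintype.card (A j) : ℝ)) (Set.finite_range _).bddAbove j
  set S : ℝ := ⨆ j, √(Fintype.card (A j) : ℝ) with hS
  set N : ℝ := (n : ℝ) - 1 with hN
  have hN1 : 1 ≤ N := by
    have : (2 : ℝ) ≤ n := by exact_mod_cast hn
    linarith
  have hS1 : 1 ≤ S := (Real.one_le_sqrt.mpr (by linarith [hA' i])).trans (hle i)
  have hcS : ∀ j, (Fintype.card (A j) : ℝ) ≤ S ^ 2 := fun j => (Real.sqrt_le_iff.mp (hle j)).2
  set η : ℝ := 1 / (128 * N * S) with hη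
  have hNS : 1 ≤ N * S := one_le_mul_of_one_le_of_one_le hN1 hS1
  have hη0 : 0 < η := by positivity
  have hηNS : η * N * S = 1 / 128 := by rw [hη]; field_simp
  have hηN : η * N ≤ 1 / 128 := by
    rw [← hηNS]; exact le_mul_of_one_le_right (by positivity) hS1
  have hη1 : η ≤ 1 / 128 := (le_mul_of_one_le_right hη0.le hN1).trans hηN
  have hreg := fun j => hx.swapRegret_le hn (fun j a => abs_le.mpr (hv j a)) hη0
    (by nlinarith) j (T := T) (by omega)
  -- This is what lets the additive `2 * η` be absorbed into the logarithmic terms.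
  have hlog : 1 / 2 ≤ Real.log T := by
    have : Real.log 2 ≤ Real.log T := Real.log_le_log two_pos (by exact_mod_cast hT)
    linarith [Real.log_two_gt_d9]
  set L : Fin n → ℝ := fun j => LogSwap.pathLength (fun t => x t j) T with hL
  have hL0 : ∀ j, 0 ≤ L j := fun j => LogSwap.pathLength_nonneg _ _
  set M : ℝ := ∑ j, (Fintype.card (A j) : ℝ) ^ 2 with hM
  set P : ℝ := ∑ j, L j with hP
  have hP0 : 0 ≤ P := Finset.sum_nonneg fun j _ => hL0 j
  set K : ℝ := 1 / S ^ 2 with hK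
  have hK0 : 0 < K := by positivity
  have hηK : η ^ 2 * N ^ 2 = K / 16384 := by
    rw [hη, hK]; field_simp; norm_num
  have hη2 : η ^ 2 ≤ K / 16384 := by
    rw [← hηK]; exact le_mul_of_one_le_right (sq_nonneg _) (one_le_pow₀ hN1)
  -- Since `8 η² ≤ K / 2048`, at least half of the negative coefficient, itself at least `K / 64` in
  -- size, survives.
  have hcK : ∀ j, 8 * η ^ 2 - 1 / (64 * (Fintype.card (A j) : ℝ)) ≤ -(K / 128) := fun j => by
    have h1 : K / 64 ≤ 1 / (64 * (Fintype.card (A j) : ℝ)) := by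
      rw [hK, div_div]
      exact one_div_le_one_div_of_le (by linarith [hA' j]) (by linarith [hcS j])
    linarith
  have hMi : (Fintype.card (A i) : ℝ) ^ 2 ≤ M :=
    Finset.single_le_sum (f := fun j => (Fintype.card (A j) : ℝ) ^ 2)
      (fun j _ => sq_nonneg _) (Finset.mem_univ i)
  have hmi : 4 ≤ (Fintype.card (A i) : ℝ) ^ 2 := by nlinarith [hA' i]
  -- The regret bounds are summed over the players and bounded below by zero. The variation terms
  -- add up to `8 η² N² P = P K / 2048`, well below the negative `P K / 128`.
  have hpath : P * K ≤ 128 * (2 * M * Real.log T) + P * K / 2 := by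
    have hsum : ∀ j, 0 ≤ (Fintype.card (A j) : ℝ) ^ 2 * Real.log T + 2 * η +
        8 * η ^ 2 * (N * (P - L j)) + -(K / 128) * L j := fun j => by
      have h0 := mul_nonneg hη0.le (LogSwap.swapRegret_nonneg (fun t => x t j)
        (fun t => LogSwap.utilityVector j (v j) (x t)) T)
      linarith [hreg j, mul_le_mul_of_nonneg_right (hcK j) (hL0 j)]
    have h1 := Finset.sum_nonneg fun j (_ : j ∈ Finset.univ) => hsum j
    simp only [Finset.sum_add_distrib, ← Finset.sum_mul, ← Finset.mul_sum,
      Finset.sum_sub_distrib, Finset.sum_const, Finset.card_univ, Fintype.card_fin,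
      nsmul_eq_mul] at h1
    have h2 : (n : ℝ) = N + 1 := by rw [hN]; ring
    rw [← hM, ← hP, h2] at h1
    have h3 : 8 * η ^ 2 * (N * ((N + 1) * P - P)) = P * K / 2048 := by
      linear_combination 8 * P * hηK
    have h4 : 1 / 2 * 4 ≤ M * Real.log T := by
      rw [mul_comm M]; exact mul_le_mul hlog (hmi.trans hMi) (by norm_num) (by linarith)
    have h5 := mul_nonneg hP0 hK0.le
    nlinarith
  have hfin : η * LogSwap.swapRegret (fun t => x t i)
      (fun t => LogSwap.utilityVector i (v i) (x t)) T ≤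
        η * (256 * S * (N * (Fintype.card (A i) : ℝ) ^ 2 + M) * Real.log T) := by
    -- An exact evaluation with `η N S = 1 / 128` and `K S² = 1`, after dropping `L i`; `hpath` then
    -- bounds `P * K`.
    have h1 : 8 * η ^ 2 * (N * (P - L i)) ≤ η * S * P * K / 16 := by
      have : 8 * η ^ 2 * (N * P) = η * S * P * K / 16 := by
        rw [hη, hK]; field_simp; ring
      rw [← this]
      have := mul_nonneg (by positivity : 0 ≤ 8 * η ^ 2 * N) (hL0 i)
      linarith
    have h2 : (8 * η ^ 2 - 1 / (64 * (Fintype.card (A i) : ℝ))) * L i ≤ 0 :=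
      mul_nonpos_of_nonpos_of_nonneg ((hcK i).trans (by linarith)) (hL0 i)
    have h3 := mul_le_mul_of_nonneg_left hpath (by positivity : 0 ≤ η * S)
    have h4 : 1 / 2 * 4 ≤ (Fintype.card (A i) : ℝ) ^ 2 * Real.log T := by
      rw [mul_comm _ (Real.log T)]; exact mul_le_mul hlog hmi (by norm_num) (by linarith)
    have h5 : η * (256 * S * (N * (Fintype.card (A i) : ℝ) ^ 2 + M) * Real.log T)
        = 2 * ((Fintype.card (A i) : ℝ) ^ 2 * Real.log T) + 256 * (η * S * (M * Real.log T)) := by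
      linear_combination 256 * (Fintype.card (A i) : ℝ) ^ 2 * Real.log T * hηNS
    have h6 : 0 ≤ η * S * (M * Real.log T) :=
      mul_nonneg (by positivity) (mul_nonneg (by linarith) (by linarith))
    rw [h5]
    linarith [hreg i]
  exact le_of_mul_le_mul_left hfin hη0
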